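/- Let $F$ and $K$ be number fields, $v$ a finite place of $F$, $q=\#(\mathcal O_F/v)$, and $G_v\subset G_F=\mathrm{Gal}(\overline F/F)$ a decomposition group at $v$. Let $\lambda$ be a prime of $K$ with residue characteristic $\ell$ and residue field $k_\lambda$, and let $\varepsilon$ be the $\ell$-adic cyclotomic character. Let $\rho\colon G_F\to \mathrm{GL}_2(K_\lambda)$ be a continuous representation which is special at $v$: over $\overline K_\lambda$, the restriction $\rho|_{G_v}$ is isomorphic to a nonsplit extension $$\begin{pmatrix}\varepsilon\chi & \ast\\ 0&\chi\end{pmatrix}$$ for some character $\chi\colon G_v\to\overline K_\lambda^\times$. (For example, $F$ is totally real, $K=K_f$ is the Hecke field of a Hilbert newform $f$ over $F$ whose automorphic representation has a special local component at $v$, $v\nmid\ell$, and $\rho=\rho_{f,\lambda}$ is the Galois representation attached to $f$.) Let $\bar\rho\colon G_F\to\mathrm{GL}_2(k_\lambda)$ be the semisimple reduction of $\rho$ modulo $\lambda$, that is, the semisimplification, as a representation of $G_F$, of the reduction modulo $\lambda$ of an integral model of $\rho$, and let $\mathrm{ad}^0\bar\rho$ be the space of trace-zero $2\times 2$ matrices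 over $k_\lambda$ with $G_F$ acting through $\bar\rho$ by conjugation. Suppose $2(q^2-1)q\not\equiv 0 \bmod \lambda$. Then $H^0(G_v,\mathrm{ad}^0\bar\rho)\neq 0$ if and only if the representation $\mathrm{ad}^0\bar\rho|_{G_v}\otimes_{k_\lambda}\overline{k}_\lambda$ of $G_v$ is semisimple. -/

import Mathlib

open IsDedekindDomain NumberField
open scoped Pointwise MatrixGroups TensorProduct

noncomputable section

namespace SpecialAdjoint

section Padic

variable {K : Type*} [Field K] [NumberField K] (l : HeightOneSpectrum (𝓞 K))
  (ℓ : ℕ) [Fact ℓ.Prime]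

/-- The ring homomorphism from the image of `ℤ` in `ℤ_ℓ` to `K_λ` sending `n` to `n`. -/
def intRangeHom : (Int.castRingHom ℤ_[ℓ]).range →+* l.adicCompletion K :=
  (Int.castRingHom (l.adicCompletion K)).comp
    (RingEquiv.ofLeftInverse
      (f := Int.castRingHom ℤ_[ℓ])
      (Function.leftInverse_invFun (RingHom.injective_int (Int.castRingHom ℤ_[ℓ])))).symm.toRingHom

theorem intRangeHom_apply (n : ℤ) (h) :
    intRangeHom l ℓ ⟨(n : ℤ_[ℓ]), h⟩ = (n : l.adicCompletion K) := by
  have : (RingEquiv.ofLeftInverse (f := Int.castRingHom ℤ_[ℓ])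
      (Function.leftInverse_invFun (RingHom.injective_int (Int.castRingHom ℤ_[ℓ])))).symm
      ⟨(n : ℤ_[ℓ]), h⟩ = n := by
    rw [RingEquiv.symm_apply_eq]; rfl
  change ((_ : ℤ) : l.adicCompletion K) = _
  exact congrArg _ this

theorem intRangeHom_uniformContinuous (hl : (ℓ : 𝓞 K) ∈ l.asIdeal) :
    UniformContinuous (intRangeHom l ℓ) := by
  have hv : Valued.v ((ℓ : ℤ) : l.adicCompletion K) < 1 := by
    have h := HeightOneSpectrum.valuedAdicCompletion_eq_valuation (K := K) l (ℓ : 𝓞 K)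
    have h2 := (l.valuation_lt_one_iff_mem (K := K) (ℓ : 𝓞 K)).2 hl
    rw [← h] at h2
    simpa using h2
  have hint : ∀ n : ℤ, Valued.v (n : l.adicCompletion K) ≤ 1 := fun n =>
    (HeightOneSpectrum.mem_adicCompletionIntegers (𝓞 K) K l).1 (intCast_mem _ n)
  refine uniformContinuous_of_continuousAt_zero (intRangeHom l ℓ) ?_
  have hpow := Valued.tendsto_zero_pow_of_v_lt_one hv
  rw [ContinuousAt, map_zero, (Valued.hasBasis_nhds_zero _ _).tendsto_right_iff]
  intro γ _
  obtain ⟨N, hN⟩ :=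
    ((Valued.hasBasis_nhds_zero _ _).tendsto_right_iff.1 hpow γ trivial).exists
  have hpos : (0 : ℝ) < (ℓ : ℝ) ^ (-N : ℤ) :=
    zpow_pos (by exact_mod_cast (Fact.out : ℓ.Prime).pos) _
  filter_upwards [Metric.ball_mem_nhds _ hpos] with x hx
  obtain ⟨_, n, rfl⟩ := x
  have hx' : ‖(n : ℤ_[ℓ])‖ ≤ (ℓ : ℝ) ^ (-N : ℤ) := by
    simpa [Metric.mem_ball, Subtype.dist_eq] using (Metric.mem_ball.1 hx).le
  obtain ⟨m, rfl⟩ := PadicInt.norm_int_le_pow_iff_dvd.1 hx'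
  have key : intRangeHom l ℓ ⟨Int.castRingHom ℤ_[ℓ] ((ℓ : ℤ) ^ N * m), _, rfl⟩
      = ((ℓ : ℤ) : l.adicCompletion K) ^ N * (m : l.adicCompletion K) := by
    rw [show (((ℓ : ℤ) : l.adicCompletion K) ^ N * (m : l.adicCompletion K))
      = (((ℓ : ℤ) ^ N * m : ℤ) : l.adicCompletion K) by push_cast; rfl]
    exact intRangeHom_apply l ℓ _ _
  simp only [Set.mem_ofPred_eq] at hN ⊢
  rw [Valuation.restrict_lt_iff_lt_embedding] at hN ⊢
  refine lt_of_le_of_lt ?_ hN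
  rw [key, map_mul]
  exact mul_le_of_le_one_right' (hint m)

/-- The structure map `ℤ_ℓ → K_λ` for a prime `λ` of residue characteristic `ℓ`: the continuous
extension of `ℤ → K_λ`. -/
def padicIntHom (hl : (ℓ : 𝓞 K) ∈ l.asIdeal) : ℤ_[ℓ] →+* l.adicCompletion K :=
  IsDenseInducing.extendRingHom (i := (Int.castRingHom ℤ_[ℓ]).range.subtype)
    (f := intRangeHom l ℓ) (isUniformInducing_val _)
    (by
      have h := PadicInt.denseRange_intCast (p := ℓ)
      refine h.mono ?_
      rintro _ ⟨n, rfl⟩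
      exact ⟨⟨(n : ℤ_[ℓ]), n, rfl⟩, rfl⟩)
    (intRangeHom_uniformContinuous l ℓ hl)

end Padic

section Galois

variable (F : Type*) [Field F] [NumberField F]

/-- The decomposition group in `Gal(F̄/F)` of a prime `P` of the ring of integers of `F̄`. When `P`
runs over the primes above a finite place `v`, these are the decomposition groups at `v`. -/
abbrev decompositionGroup (P : Ideal (𝓞 (AlgebraicClosure F))) :
    Subgroup Gal(AlgebraicClosure F/F) :=
  MulAction.stabilizer Gal(AlgebraicClosure F/F) P

variable {F} {K : Type*} [Field K] [NumberField K] (l : HeightOneSpectrum (𝓞 K))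
  (ℓ : ℕ) [Fact ℓ.Prime] (hl : (ℓ : 𝓞 K) ∈ l.asIdeal)

/-- The `ℓ`-adic cyclotomic character of `Gal(F̄/F)`, with values in `K_λ`. -/
def cyclo (g : Gal(AlgebraicClosure F/F)) : l.adicCompletion K :=
  padicIntHom l ℓ hl (cyclotomicCharacter (AlgebraicClosure F) ℓ g.toRingEquiv : ℤ_[ℓ])

/-- `ρ` is special at the place below `P`: over an algebraic closure of `K_λ`, the restriction of
`ρ` to the decomposition group is a nonsplit extension of `χ` by `εχ`, for some character `χ`.
(Continuity of `χ` is automatic from that of `ρ`.) -/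
def IsSpecialAt (P : Ideal (𝓞 (AlgebraicClosure F)))
    (ρ : Gal(AlgebraicClosure F/F) →* GL (Fin 2) (l.adicCompletion K)) : Prop :=
  let ι := algebraMap (l.adicCompletion K) (AlgebraicClosure (l.adicCompletion K))
  ∃ χ : decompositionGroup F P →* (AlgebraicClosure (l.adicCompletion K))ˣ,
    (∃ (A : GL (Fin 2) (AlgebraicClosure (l.adicCompletion K)))
        (b : decompositionGroup F P → AlgebraicClosure (l.adicCompletion K)),
      ∀ g : decompositionGroup F P,
        (A * Matrix.GeneralLinearGroup.map ι (ρ g) * A⁻¹).val = !![ι (cyclo l ℓ hl g.1) * χ g, b g; 0, χ g]) ∧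
    ¬ ∃ A : GL (Fin 2) (AlgebraicClosure (l.adicCompletion K)),
      ∀ g : decompositionGroup F P,
        (A * Matrix.GeneralLinearGroup.map ι (ρ g) * A⁻¹).val = !![ι (cyclo l ℓ hl g.1) * χ g, 0; 0, χ g]

end Galois

section Residual

variable {G : Type*} [Group G] {k : Type*} [Field k]

/-- The representation on column vectors given by a homomorphism to `GL₂(k)`. -/
def stdRep (r : G →* GL (Fin 2) k) : Representation k G (Fin 2 → k) :=
  (Units.coeHom _).comp (Matrix.GeneralLinearGroup.toLin.toMonoidHom.comp r)

/-- `s` is (isomorphic to) the semisimplification of the two-dimensional representation `r`: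
either `r` is irreducible and `s ≅ r`, or `r` is an extension of a character `b` by a character
`a` and `s ≅ a ⊕ b`. -/
def IsSemisimplification (r s : G →* GL (Fin 2) k) : Prop :=
  ((stdRep r).IsIrreducible ∧ ∃ A : GL (Fin 2) k, ∀ g, s g = A * r g * A⁻¹) ∨
  ∃ (a b : G →* kˣ) (c : G → k) (A B : GL (Fin 2) k), ∀ g,
    (A * r g * A⁻¹).val = !![(a g : k), c g; 0, (b g : k)] ∧
    (B * s g * B⁻¹).val = !![(a g : k), 0; 0, (b g : k)]

variable {K : Type*} [Field K] [NumberField K] (l : HeightOneSpectrum (𝓞 K))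

/-- The residue field `k_λ` of `K` at `λ`, as the residue field of the integers of `K_λ`. -/
abbrev resField : Type _ := IsLocalRing.ResidueField (l.adicCompletionIntegers K)

/-- `ρ'` is the semisimple residual representation of `ρ`: the semisimplification of the
reduction modulo `λ` of an integral model of `ρ`. -/
def IsSemisimpleReduction (ρ : G →* GL (Fin 2) (l.adicCompletion K))
    (ρ' : G →* GL (Fin 2) (resField l)) : Prop :=
  ∃ (ρ₀ : G →* GL (Fin 2) (l.adicCompletionIntegers K)) (A : GL (Fin 2) (l.adicCompletion K)),
    (∀ g, Matrix.GeneralLinearGroup.map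
        (algebraMap (l.adicCompletionIntegers K) (l.adicCompletion K)) (ρ₀ g)
      = A * ρ g * A⁻¹) ∧
    IsSemisimplification
      ((Matrix.GeneralLinearGroup.map
        (IsLocalRing.residue (l.adicCompletionIntegers K))).comp ρ₀) ρ'

/-- The trace-zero `2 × 2` matrices. -/
abbrev TraceZero (k : Type*) [Field k] : Submodule k (Matrix (Fin 2) (Fin 2) k) :=
  LinearMap.ker (Matrix.traceLinearMap (Fin 2) k k)

/-- `ad⁰ r`: the conjugation action on trace-zero matrices. -/
def adZero (r : G →* GL (Fin 2) k) : Representation k G (TraceZero k) where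
  toFun g :=
    { toFun := fun X => ⟨(r g).val * X.1 * (r g)⁻¹.val, by
        have hX : Matrix.trace X.1 = 0 := X.2
        change Matrix.trace ((r g).val * X.1 * (r g)⁻¹.val) = 0
        rw [Matrix.trace_mul_comm, ← mul_assoc, ← Units.val_mul, inv_mul_cancel,
          Units.val_one, one_mul, hX]⟩
      map_add' := fun X Y => Subtype.ext (by simp [mul_add, add_mul])
      map_smul' := fun c X => Subtype.ext (by simp) }
  map_one' := by ext1 X; exact Subtype.ext (by simp)
  map_mul' g h := by
    ext1 X
    exact Subtype.ext (by simp only [map_mul, mul_inv_rev, Units.val_mul]; simp [mul_assoc])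

/-- Extension of scalars `L ⊗_k V` of a representation `V` over `k`. -/
def extendScalars (L : Type*) [Field L] [Algebra k L] {V : Type*} [AddCommGroup V] [Module k V]
    (r : Representation k G V) : Representation L G (L ⊗[k] V) :=
  (Module.End.baseChangeHom k L V).toRingHom.toMonoidHom.comp r

end Residual

end SpecialAdjoint

end

/-!
If `ρ̄` is reducible, its semisimplification is diagonal in a suitable basis, and then `diag(1, -1)`
is invariant while the matrix units are eigenvectors, so both conditions hold.

If `ρ̄` is irreducible, it is the reduction of an integral model of `ρ`. A Frobenius element at `v`
acts on `ρ` with eigenvalues `qt` and `t`, where `t` lies in the ring of integers because `q + 1` is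
a unit. As `q - 1` is a unit too, these eigenvalues remain distinct modulo `λ`. Hence the reduction
has a basis in which the decomposition group is upper triangular and Frobenius is diagonal with
distinct entries. There, an invariant of `ad⁰` commutes with Frobenius, so it is a multiple of
`diag(1, -1)`; and when `ad⁰` is semisimple, `diag(1, -1)` is invariant, being fixed by Frobenius
and invariant modulo the line of the upper right matrix unit, on which Frobenius has no fixed
vectors. Finally, `diag(1, -1)` is invariant if and only if the group is diagonal, as `2` is
invertible.
-/

namespace SpecialAdjoint

open Representation

section Semisimple

variable {G k V : Type*} [Group G] [Field k] [AddCommGroup V] [Module k V]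
  {r : Representation k G V}

/-- The line spanned by a common eigenvector of `G`, as a subrepresentation. -/
def eigenline (r : Representation k G V) (v : V) (hv : ∀ g, ∃ c : k, r g v = c • v) :
    Subrepresentation r where
  toSubmodule := Submodule.span k {v}
  apply_mem_toSubmodule g w hw := by
    obtain ⟨x, rfl⟩ := Submodule.mem_span_singleton.1 hw
    obtain ⟨c, hc⟩ := hv g
    rw [map_smul, hc]
    exact Submodule.smul_mem _ _ (Submodule.smul_mem _ _ (Submodule.mem_span_singleton_self v))

theorem mem_eigenline_iff {v : V} {hv : ∀ g, ∃ c : k, r g v = c • v} {w : V} :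
    w ∈ eigenline r v hv ↔ ∃ x : k, x • v = w :=
  Submodule.mem_span_singleton

open scoped MonoidAlgebra in
theorem isSimpleModule_eigenline {v : V} (hv : ∀ g, ∃ c : k, r g v = c • v) (hv₀ : v ≠ 0) :
    IsSimpleModule k[G] (eigenline r v hv).asSubmodule := by
  rw [isSimpleModule_iff_isAtom]
  refine (OrderIso.isAtom_iff Subrepresentation.subrepresentationSubmoduleOrderIso _).2 ?_
  let toSubmodule : Subrepresentation r ↪o Submodule k V :=
    ⟨⟨Subrepresentation.toSubmodule, Subrepresentation.toSubmodule_injective⟩, Iff.rfl⟩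
  exact toSubmodule.isAtom_of_map_bot_of_image rfl (nonzero_span_atom v hv₀)

theorem isSemisimpleRepresentation_of_span_eigenvectors {S : Set V}
    (hspan : Submodule.span k S = ⊤) (hS : ∀ v ∈ S, ∀ g, ∃ c : k, r g v = c • v) :
    r.IsSemisimpleRepresentation := by
  rw [isSemisimpleRepresentation_iff_isSemisimpleModule_asModule]
  refine .of_sSup_simples_eq_top (eq_top_iff.2 fun w _ => ?_)
  suffices h : Submodule.span k S ≤ (Subrepresentation.ofSubmodule' (ρ := r) (sSup _)).toSubmodule
    from h (hspan ▸ Submodule.mem_top (x := (w : V)))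
  refine Submodule.span_le.2 fun v hv => ?_
  by_cases hv₀ : v = 0
  · exact hv₀ ▸ zero_mem _
  · exact le_sSup (a := (eigenline r v (hS v hv)).asSubmodule)
      (isSimpleModule_eigenline (hS v hv) hv₀) (Submodule.mem_span_singleton_self v)

/-- An invariant of the quotient by `W` that is already fixed by an element acting without
nonzero fixed vectors on `W` is itself invariant: its component along a complement of `W`
is invariant, so its component in `W` is fixed by that element. -/
theorem mem_invariants_of_sub_mem (hr : r.IsSemisimpleRepresentation) (W : Subrepresentation r)
    {g₀ : G} (hW : ∀ w ∈ W, r g₀ w = w → w = 0) {h : V} (hh : ∀ g, r g h - h ∈ W)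
    (hg₀ : r g₀ h = h) : h ∈ r.invariants := by
  obtain ⟨C, hC⟩ := hr.exists_isCompl W
  have hinf : W.toSubmodule ⊓ C.toSubmodule = ⊥ :=
    congrArg Subrepresentation.toSubmodule hC.inf_eq_bot
  have hsup : W.toSubmodule ⊔ C.toSubmodule = ⊤ :=
    congrArg Subrepresentation.toSubmodule hC.sup_eq_top
  obtain ⟨y, hy, z, hz, rfl⟩ := Submodule.mem_sup.1 (hsup ▸ Submodule.mem_top (x := h))
  have hz_inv (g : G) : r g z = z := by
    have hW' : r g z - z ∈ W.toSubmodule := by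
      have : r g z - z = (r g (y + z) - (y + z)) - (r g y - y) := by rw [map_add]; abel
      rw [this]
      exact sub_mem (hh g) (sub_mem (W.apply_mem_toSubmodule g hy) hy)
    have : r g z - z ∈ W.toSubmodule ⊓ C.toSubmodule :=
      ⟨hW', sub_mem (C.apply_mem_toSubmodule g hz) hz⟩
    rwa [hinf, Submodule.mem_bot, sub_eq_zero] at this
  have hy₀ : y = 0 := hW y hy (by rwa [map_add, hz_inv, add_left_inj] at hg₀)
  rwa [hy₀, zero_add]

end Semisimple

section ExtendScalars

variable {G k V : Type*} [Group G] [Field k] [AddCommGroup V] [Module k V]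
  (L : Type*) [Field L] [Algebra k L] {r : Representation k G V}

theorem extendScalars_tmul (r : Representation k G V) (g : G) (x : L) (v : V) :
    extendScalars L r g (x ⊗ₜ[k] v) = x ⊗ₜ[k] r g v :=
  LinearMap.baseChange_tmul _ _ _

theorem extendScalars_one_tmul_eq_smul {g : G} {v : V} {c : k} (h : r g v = c • v) :
    extendScalars L r g ((1 : L) ⊗ₜ[k] v) = algebraMap k L c • (1 : L) ⊗ₜ[k] v := by
  rw [extendScalars_tmul, h, TensorProduct.tmul_smul, algebraMap_smul]

theorem extendScalars_isSemisimple_of_span_eigenvectors {S : Set V}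
    (hspan : Submodule.span k S = ⊤) (hS : ∀ v ∈ S, ∀ g, ∃ c : k, r g v = c • v) :
    (extendScalars L r).IsSemisimpleRepresentation := by
  refine isSemisimpleRepresentation_of_span_eigenvectors
    (S := (TensorProduct.mk k L V 1) '' S) ?_ ?_
  · rw [← Submodule.baseChange_span, hspan, Submodule.baseChange_top]
  · rintro _ ⟨v, hv, rfl⟩ g
    obtain ⟨c, hc⟩ := hS v hv g
    exact ⟨algebraMap k L c, extendScalars_one_tmul_eq_smul L hc⟩

theorem mem_invariants_of_extendScalars_isSemisimple
    (hss : (extendScalars L r).IsSemisimpleRepresentation) {e h : V} {α β : G → k}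
    (he : ∀ g, r g e = α g • e) (hh : ∀ g, r g h = h + β g • e) {g₀ : G} (hα : α g₀ ≠ 1)
    (hβ : β g₀ = 0) : h ∈ r.invariants := by
  have he' g := extendScalars_one_tmul_eq_smul L (he g)
  have hmem : (1 : L) ⊗ₜ[k] h ∈ (extendScalars L r).invariants := by
    refine mem_invariants_of_sub_mem hss (eigenline _ ((1 : L) ⊗ₜ[k] e) fun g => ⟨_, he' g⟩)
      (g₀ := g₀) (fun w hw hfix => ?_) (fun g => ?_) ?_
    · obtain ⟨x, rfl⟩ := mem_eigenline_iff.1 hw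
      have hα' : algebraMap k L (α g₀) - 1 ≠ 0 :=
        sub_ne_zero.2 ((map_ne_one_iff _ (algebraMap k L).injective).2 hα)
      refine (smul_eq_zero.1 ?_).resolve_left hα'
      rw [sub_smul, one_smul, sub_eq_zero, smul_comm, ← he', ← map_smul, hfix]
    · rw [extendScalars_tmul, hh, TensorProduct.tmul_add, add_sub_cancel_left, mem_eigenline_iff]
      exact ⟨algebraMap k L (β g), by rw [TensorProduct.tmul_smul, algebraMap_smul]⟩
    · rw [extendScalars_tmul, hh, hβ, zero_smul, add_zero]
  intro g
  have := hmem g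
  rw [extendScalars_tmul] at this
  exact Module.FaithfullyFlat.tensorProduct_mk_injective (A := k) (B := L) V this

end ExtendScalars

section Equivalence

variable {G k V W : Type*} [Group G] [Field k] [AddCommGroup V] [Module k V] [AddCommGroup W]
  [Module k W] {r : Representation k G V} {s : Representation k G W}

theorem isSemisimpleRepresentation_congr (φ : r.Equiv s) :
    r.IsSemisimpleRepresentation ↔ s.IsSemisimpleRepresentation := by
  simp only [isSemisimpleRepresentation_iff_isSemisimpleModule_asModule]
  exact (LinearEquiv.ofBijective (IntertwiningMap.equivLinearMapAsModule r s φ.toIntertwiningMap)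
    φ.toLinearEquiv.bijective).isSemisimpleModule_iff

/-- The extension of scalars of an equivalence of representations. -/
def extendScalarsEquiv (L : Type*) [Field L] [Algebra k L] (φ : r.Equiv s) :
    (extendScalars L r).Equiv (extendScalars L s) :=
  .mk (φ.toLinearEquiv.baseChange k L V W) fun g => by
    ext v
    exact congrArg ((1 : L) ⊗ₜ[k] ·) (φ.isIntertwining _ _ g v)

theorem invariants_eq_bot_congr (φ : r.Equiv s) : r.invariants = ⊥ ↔ s.invariants = ⊥ := by
  have hcomap : r.invariants = s.invariants.comap φ.toLinearEquiv.toLinearMap := by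
    ext v
    refine forall_congr' fun g => ?_
    have hφ : φ.toLinearEquiv (r g v) = s g (φ.toLinearEquiv v) := φ.isIntertwining _ _ g v
    exact φ.toLinearEquiv.injective.eq_iff.symm.trans (by rw [hφ]; rfl)
  rw [hcomap, Submodule.comap_equiv_eq_map_symm, Submodule.map_eq_bot_iff]

end Equivalence

section Adjoint

variable {G k : Type*} [Group G] [Field k] {r : G →* GL (Fin 2) k}

theorem adZero_apply_eq_iff {g : G} {X Y : TraceZero k} :
    adZero r g X = Y ↔ (r g).val * X.1 = Y.1 * (r g).val := by
  rw [Subtype.ext_iff]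
  exact Units.mul_inv_eq_iff_eq_mul (r g)

theorem mem_invariants_adZero_iff {X : TraceZero k} :
    X ∈ (adZero r).invariants ↔ ∀ g, Commute (r g).val X.1 :=
  forall_congr' fun _ => adZero_apply_eq_iff

/-- Conjugation by `B`, as an equivalence between the adjoint representations of `r` and of
`B * r * B⁻¹`. -/
noncomputable def adZeroConj (r : G →* GL (Fin 2) k) (B : GL (Fin 2) k) :
    (adZero r).Equiv (adZero ((MulAut.conj B).toMonoidHom.comp r)) :=
  .mk (LinearEquiv.ofBijective (adZero (MonoidHom.id (GL (Fin 2) k)) B) (apply_bijective _ B))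
    fun g => by
      change adZero (MonoidHom.id _) B * adZero (MonoidHom.id _) (r g) =
        adZero (MonoidHom.id _) (B * r g * B⁻¹) * adZero (MonoidHom.id _) B
      rw [← map_mul, ← map_mul, inv_mul_cancel_right]

/-- The trace-zero matrix with rows `(x, y)` and `(z, -x)`. -/
def traceZeroOf (x y z : k) : TraceZero k :=
  ⟨!![x, y; z, -x], by simp [Matrix.trace_fin_two]⟩

theorem exists_eq_traceZeroOf (X : TraceZero k) : ∃ x y z, X = traceZeroOf x y z := by
  have htr : X.1 0 0 + X.1 1 1 = 0 := by rw [← Matrix.trace_fin_two]; exact X.2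
  refine ⟨X.1 0 0, X.1 0 1, X.1 1 0, ?_⟩
  ext i j
  fin_cases i <;> fin_cases j <;> simp [traceZeroOf, eq_neg_of_add_eq_zero_right htr]

theorem span_traceZeroOf :
    Submodule.span k {traceZeroOf (1 : k) 0 0, traceZeroOf 0 1 0, traceZeroOf 0 0 1} = ⊤ := by
  refine eq_top_iff.2 fun X _ => Submodule.mem_span_triple.2 ?_
  obtain ⟨x, y, z, rfl⟩ := exists_eq_traceZeroOf X
  refine ⟨x, y, z, ?_⟩
  ext i j
  fin_cases i <;> fin_cases j <;> simp [traceZeroOf]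

theorem diag_ne_zero_of_triangular {T : GL (Fin 2) k} {a c d : k} (hT : T.val = !![a, c; 0, d]) :
    a ≠ 0 ∧ d ≠ 0 := by
  have hdet : T.val.det ≠ 0 := T.det_ne_zero
  rw [hT, Matrix.det_fin_two_of, mul_zero, sub_zero] at hdet
  exact mul_ne_zero_iff.1 hdet

theorem invariants_ne_bot_of_traceZeroOf_mem (h : traceZeroOf 1 0 0 ∈ (adZero r).invariants) :
    (adZero r).invariants ≠ ⊥ :=
  (Submodule.ne_bot_iff _).2
    ⟨_, h, fun h₀ => one_ne_zero (congrFun₂ (congrArg Subtype.val h₀) 0 0)⟩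

section Diagonal

variable {a d : G → k} (hr : ∀ g, (r g).val = !![a g, 0; 0, d g])
include hr

theorem extendScalars_adZero_isSemisimple_of_diagonal (L : Type*) [Field L] [Algebra k L] :
    (extendScalars L (adZero r)).IsSemisimpleRepresentation := by
  refine extendScalars_isSemisimple_of_span_eigenvectors L span_traceZeroOf ?_
  have had g := diag_ne_zero_of_triangular (hr g)
  rintro _ (rfl | rfl | rfl) g
  · refine ⟨1, adZero_apply_eq_iff.2 ?_⟩
    simp [hr, traceZeroOf]
  · refine ⟨a g / d g, adZero_apply_eq_iff.2 ?_⟩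
    simp [hr, traceZeroOf, (had g).2]
  · refine ⟨d g / a g, adZero_apply_eq_iff.2 ?_⟩
    simp [hr, traceZeroOf, (had g).1]

theorem adZero_invariants_ne_bot_of_diagonal : (adZero r).invariants ≠ ⊥ := by
  refine invariants_ne_bot_of_traceZeroOf_mem (mem_invariants_adZero_iff.2 fun g => ?_)
  simp [hr, traceZeroOf, commute_iff_eq]

end Diagonal

section Triangular

/-- A trace-zero matrix commuting with a diagonal matrix with distinct entries is a multiple
of `diag(1, -1)`. -/
theorem traceZeroOf_mem_invariants_of_ne_bot {g₀ : G} {a₀ d₀ : k}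
    (hg₀ : (r g₀).val = !![a₀, 0; 0, d₀]) (hne : a₀ ≠ d₀) (hinv : (adZero r).invariants ≠ ⊥) :
    traceZeroOf 1 0 0 ∈ (adZero r).invariants := by
  obtain ⟨X, hX, hX₀⟩ := Submodule.exists_mem_ne_zero_of_ne_bot hinv
  obtain ⟨x, y, z, rfl⟩ := exists_eq_traceZeroOf X
  have hcomm : (r g₀).val * !![x, y; z, -x] = !![x, y; z, -x] * (r g₀).val :=
    mem_invariants_adZero_iff.1 hX g₀
  rw [hg₀] at hcomm
  have h01 : a₀ * y = y * d₀ := by simpa using congrFun₂ hcomm 0 1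
  have h10 : d₀ * z = z * a₀ := by simpa using congrFun₂ hcomm 1 0
  obtain rfl : y = 0 :=
    (mul_eq_zero.1 (by linear_combination h01)).resolve_left (sub_ne_zero.2 hne)
  obtain rfl : z = 0 :=
    (mul_eq_zero.1 (by linear_combination -h10)).resolve_left (sub_ne_zero.2 hne)
  have hx : x ≠ 0 := by
    rintro rfl
    exact hX₀ (by ext i j; fin_cases i <;> fin_cases j <;> simp [traceZeroOf])
  convert! Submodule.smul_mem _ x⁻¹ hX
  ext i j
  fin_cases i <;> fin_cases j <;> simp [traceZeroOf, hx]

variable {a c d : G → k} (hr : ∀ g, (r g).val = !![a g, c g; 0, d g])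
include hr

theorem upperRight_eq_zero_of_traceZeroOf_mem (h2 : (2 : k) ≠ 0)
    (h : traceZeroOf 1 0 0 ∈ (adZero r).invariants) (g : G) : c g = 0 := by
  have hcomm : (r g).val * !![1, 0; 0, -1] = !![1, 0; 0, -1] * (r g).val :=
    mem_invariants_adZero_iff.1 h g
  have h01 : -c g = c g := by simpa [hr] using congrFun₂ hcomm 0 1
  exact (mul_eq_zero.1 (by linear_combination -h01)).resolve_left h2

theorem traceZeroOf_mem_invariants_of_isSemisimple {g₀ : G} (hg₀ : a g₀ ≠ d g₀)
    (hc₀ : c g₀ = 0) {L : Type*} [Field L] [Algebra k L]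
    (hss : (extendScalars L (adZero r)).IsSemisimpleRepresentation) :
    traceZeroOf 1 0 0 ∈ (adZero r).invariants := by
  have hd g := (diag_ne_zero_of_triangular (hr g)).2
  refine mem_invariants_of_extendScalars_isSemisimple L hss (e := traceZeroOf 0 1 0)
    (α := fun g => a g / d g) (β := fun g => -(2 * c g / d g)) (g₀ := g₀)
    (fun g => adZero_apply_eq_iff.2 ?_) (fun g => adZero_apply_eq_iff.2 ?_) ?_ ?_
  · simp [hr, traceZeroOf, hd]
  · ext i j
    fin_cases i <;> fin_cases j <;> simp [hr, traceZeroOf, hd]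
    ring
  · rwa [Ne, div_eq_one_iff_eq (hd g₀)]
  · simp [hc₀]

theorem adZero_invariants_ne_bot_iff_of_triangular (h2 : (2 : k) ≠ 0) {g₀ : G} (hg₀ : a g₀ ≠ d g₀)
    (hc₀ : c g₀ = 0) (L : Type*) [Field L] [Algebra k L] :
    (adZero r).invariants ≠ ⊥ ↔ (extendScalars L (adZero r)).IsSemisimpleRepresentation := by
  refine ⟨fun hinv => ?_, fun hss => invariants_ne_bot_of_traceZeroOf_mem
    (traceZeroOf_mem_invariants_of_isSemisimple hr hg₀ hc₀ hss)⟩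
  have hmem := traceZeroOf_mem_invariants_of_ne_bot (hc₀ ▸ hr g₀) hg₀ hinv
  have hc := upperRight_eq_zero_of_traceZeroOf_mem hr h2 hmem
  exact extendScalars_adZero_isSemisimple_of_diagonal (fun g => hc g ▸ hr g) L

end Triangular

theorem adZero_invariants_ne_bot_iff_of_conj_diagonal {a d : G → k} {B : GL (Fin 2) k}
    (hr : ∀ g, (B * r g * B⁻¹).val = !![a g, 0; 0, d g]) (L : Type*) [Field L] [Algebra k L] :
    (adZero r).invariants ≠ ⊥ ↔ (extendScalars L (adZero r)).IsSemisimpleRepresentation := by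
  rw [Ne, invariants_eq_bot_congr (adZeroConj r B),
    isSemisimpleRepresentation_congr (extendScalarsEquiv L (adZeroConj r B))]
  exact iff_of_true (adZero_invariants_ne_bot_of_diagonal hr)
    (extendScalars_adZero_isSemisimple_of_diagonal hr L)

theorem adZero_invariants_ne_bot_iff_of_conj_triangular (h2 : (2 : k) ≠ 0) {a c d : G → k}
    {B : GL (Fin 2) k} (hr : ∀ g, (B * r g * B⁻¹).val = !![a g, c g; 0, d g]) {g₀ : G}
    (hg₀ : a g₀ ≠ d g₀) (hc₀ : c g₀ = 0) (L : Type*) [Field L] [Algebra k L] :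
    (adZero r).invariants ≠ ⊥ ↔ (extendScalars L (adZero r)).IsSemisimpleRepresentation := by
  rw [Ne, invariants_eq_bot_congr (adZeroConj r B),
    isSemisimpleRepresentation_congr (extendScalarsEquiv L (adZeroConj r B))]
  exact adZero_invariants_ne_bot_iff_of_triangular hr h2 hg₀ hc₀ L

end Adjoint

section ConjMap

variable {R Ω n : Type*} [CommRing R] [CommRing Ω] [Fintype n] [DecidableEq n]

/-- The ring homomorphism `N ↦ A * φ(N) * A⁻¹` between matrix rings. -/
def conjMap (φ : R →+* Ω) (A : GL n Ω) : Matrix n n R →+* Matrix n n Ω :=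
  (MulSemiringAction.toRingHom _ _ (ConjAct.toConjAct A)).comp φ.mapMatrix

variable (φ : R →+* Ω) (A : GL n Ω)

theorem conjMap_apply (N : Matrix n n R) : conjMap φ A N = A.val * N.map φ * A⁻¹.val :=
  rfl

theorem conjMap_injective (hφ : Function.Injective φ) : Function.Injective (conjMap φ A) :=
  (MulAction.injective (ConjAct.toConjAct A)).comp (Matrix.map_injective hφ)

theorem conjMap_smul (x : R) (N : Matrix n n R) : conjMap φ A (x • N) = φ x • conjMap φ A N := by
  rw [conjMap_apply, conjMap_apply, Matrix.map_smul' _ _ _ (map_mul φ), mul_smul_comm,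
    smul_mul_assoc]

theorem trace_conjMap (N : Matrix n n R) : (conjMap φ A N).trace = φ N.trace := by
  rw [conjMap_apply, Matrix.trace_units_conj]
  exact (AddMonoidHom.map_trace φ N).symm

theorem det_conjMap (N : Matrix n n R) : (conjMap φ A N).det = φ N.det := by
  rw [conjMap_apply, Matrix.det_units_conj, RingHom.map_det]
  rfl

end ConjMap

section Eigenvalue

variable {R Ω : Type*} [CommRing R] [CommRing Ω] {φ : R →+* Ω} {A : GL (Fin 2) Ω}
  {M : Matrix (Fin 2) (Fin 2) R} {e : R} {b : Ω}

theorem exists_unit_eigenvalue (hφ : Function.Injective φ) {x : Ω} (hM : IsUnit M)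
    (hconj : conjMap φ A M = !![φ e * x, b; 0, x]) (he : IsUnit (e + 1)) :
    ∃ t : Rˣ, φ t = x := by
  obtain ⟨u, hu⟩ := he
  have htrace : φ M.trace = φ u * x := by
    rw [← trace_conjMap φ A, hconj, Matrix.trace_fin_two_of, hu, map_add, map_one]
    ring
  have ht : φ (↑u⁻¹ * M.trace) = x := by
    rw [map_mul, htrace, ← mul_assoc, ← map_mul, Units.inv_mul, map_one, one_mul]
  have hdet : M.det = e * (↑u⁻¹ * M.trace) * (↑u⁻¹ * M.trace) := hφ (by
    rw [map_mul, map_mul, ht, ← det_conjMap φ A, hconj, Matrix.det_fin_two_of, mul_zero, sub_zero])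
  have hunit : IsUnit (↑u⁻¹ * M.trace) :=
    isUnit_of_mul_isUnit_right (hdet ▸ (Matrix.isUnit_iff_isUnit_det M).1 hM)
  exact ⟨hunit.unit, ht⟩

variable {t : R} (hconj : conjMap φ A M = !![φ e * φ t, b; 0, φ t])
include hconj

theorem conjMap_sub_scalar :
    conjMap φ A (M - t • 1) = !![φ ((e - 1) * t), b; 0, 0] := by
  rw [map_sub, conjMap_smul, map_one, hconj]
  ext i j
  fin_cases i <;> fin_cases j <;> simp [sub_mul]

theorem trace_sub_scalar (hφ : Function.Injective φ) : (M - t • 1).trace = (e - 1) * t :=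
  hφ (by rw [← trace_conjMap φ A, conjMap_sub_scalar hconj, Matrix.trace_fin_two_of, add_zero])

theorem det_sub_scalar (hφ : Function.Injective φ) : (M - t • 1).det = 0 :=
  hφ (by simp [← det_conjMap φ A, conjMap_sub_scalar hconj])

/-- The image of `M - t` is the line on which upper triangular matrices act by their first
diagonal entry; multiplying by the trace expresses this without leaving `R`. -/
theorem trace_smul_mul_sub_scalar (hφ : Function.Injective φ) {N : Matrix (Fin 2) (Fin 2) R}
    {x y z : Ω} (hN : conjMap φ A N = !![x, y; 0, z]) :
    (M - t • 1).trace • (N * (M - t • 1)) = (N * (M - t • 1)).trace • (M - t • 1) := by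
  refine conjMap_injective φ A hφ ?_
  rw [conjMap_smul, conjMap_smul, ← trace_conjMap φ A, ← trace_conjMap φ A, map_mul, hN,
    conjMap_sub_scalar hconj]
  ext i j
  fin_cases i <;> fin_cases j <;> simp [Matrix.trace_fin_two] <;> ring

end Eigenvalue

section Eigenbasis

variable {G k : Type*} [Group G] [Field k]

theorem conj_mulVec_single {n : Type*} [Fintype n] [DecidableEq n] {Q : GL n k}
    {S : Matrix n n k} {j : n} {x : k} (h : S.mulVec (Q.val.col j) = x • Q.val.col j) :
    (Q⁻¹.val * S * Q.val).col j = Pi.single j x := by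
  rw [← Matrix.mulVec_single_one, ← Matrix.mulVec_mulVec, Matrix.mulVec_single_one,
    ← Matrix.mulVec_mulVec, h, Matrix.mulVec_smul, ← Matrix.mulVec_single_one Q.val,
    Matrix.mulVec_mulVec, ← Units.val_mul, inv_mul_cancel, Units.val_one, Matrix.one_mulVec,
    ← Pi.single_smul, smul_eq_mul, mul_one]

theorem exists_conj_triangular_of_eigenvectors {s : G →* GL (Fin 2) k} {u w : Fin 2 → k}
    (huw : LinearIndependent k ![u, w]) {a : G → k} (hu : ∀ g, (s g).val.mulVec u = a g • u)
    {g₀ : G} {t : k} (hw : (s g₀).val.mulVec w = t • w) :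
    ∃ (B : GL (Fin 2) k) (c d : G → k),
      (∀ g, (B * s g * B⁻¹).val = !![a g, c g; 0, d g]) ∧ d g₀ = t ∧ c g₀ = 0 := by
  have hunit : IsUnit (Matrix.of ![u, w]).transpose :=
    Matrix.linearIndependent_cols_iff_isUnit.1 huw
  obtain ⟨Q, hQ⟩ := hunit
  have hQ₀ : Q.val.col 0 = u := by rw [hQ]; rfl
  have hQ₁ : Q.val.col 1 = w := by rw [hQ]; rfl
  let T (g : G) : Matrix (Fin 2) (Fin 2) k := Q⁻¹.val * (s g).val * Q.val
  have hT₀ (g : G) : (T g).col 0 = Pi.single 0 (a g) := conj_mulVec_single (hQ₀ ▸ hu g)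
  have hT₁ : (T g₀).col 1 = Pi.single 1 t := conj_mulVec_single (hQ₁ ▸ hw)
  refine ⟨Q⁻¹, fun g => T g 0 1, fun g => T g 1 1, fun g => ?_, congrFun hT₁ 1, congrFun hT₁ 0⟩
  rw [inv_inv, ← show T g 0 0 = a g from congrFun (hT₀ g) 0,
    ← show T g 1 0 = 0 from congrFun (hT₀ g) 1]
  exact Matrix.eta_fin_two (T g)

theorem exists_conj_triangular_of_sub_scalar {s : G →* GL (Fin 2) k} {g₀ : G} {t : k}
    {D : Matrix (Fin 2) (Fin 2) k} (hD : D = (s g₀).val - t • 1) (hdet : D.det = 0)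
    (htrace : D.trace ≠ 0)
    (hline : ∀ g, D.trace • ((s g).val * D) = ((s g).val * D).trace • D) :
    ∃ (B : GL (Fin 2) k) (a c d : G → k),
      (∀ g, (B * s g * B⁻¹).val = !![a g, c g; 0, d g]) ∧ a g₀ ≠ d g₀ ∧ c g₀ = 0 := by
  let a (g : G) : k := D.trace⁻¹ * ((s g).val * D).trace
  have ha (g : G) : (s g).val * D = a g • D := by
    rw [mul_smul, ← hline, inv_smul_smul₀ htrace]
  have hDD : D * D = (a g₀ - t) • D := by
    nth_rewrite 1 [hD]
    rw [sub_mul, ha, smul_mul_assoc, one_mul, sub_smul]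
  have hat : a g₀ ≠ t := by
    intro h
    rw [h, sub_self, zero_smul] at hDD
    exact htrace (Matrix.isNilpotent_trace_of_isNilpotent ⟨2, (sq D).trans hDD⟩).eq_zero
  obtain ⟨x, hx⟩ : ∃ x, D.mulVec x ≠ 0 := by
    by_contra! h
    exact htrace (by rw [Matrix.mulVec_injective (funext fun x => (h x).trans
      (Matrix.zero_mulVec x).symm), Matrix.trace_zero])
  obtain ⟨w, hw, hDw⟩ := Matrix.exists_mulVec_eq_zero_iff.2 hdet
  have hu (g : G) : (s g).val.mulVec (D.mulVec x) = a g • D.mulVec x := by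
    rw [Matrix.mulVec_mulVec, ha, Matrix.smul_mulVec]
  have hw₀ : (s g₀).val.mulVec w = t • w := by
    rw [hD, Matrix.sub_mulVec, Matrix.smul_mulVec, Matrix.one_mulVec] at hDw
    exact sub_eq_zero.1 hDw
  have huw : LinearIndependent k ![D.mulVec x, w] := by
    refine (LinearIndependent.pair_iff' hx).2 fun y hy => hw ?_
    rw [← hy, Matrix.mulVec_smul, Matrix.mulVec_mulVec, hDD, Matrix.smul_mulVec, smul_smul,
      smul_eq_zero_iff_left hx] at hDw
    rw [← hy, (mul_eq_zero.1 hDw).resolve_right (sub_ne_zero.2 hat), zero_smul]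
  obtain ⟨B, c, d, hB, hd, hc⟩ := exists_conj_triangular_of_eigenvectors huw hu hw₀
  exact ⟨B, a, c, d, hB, hd ▸ hat, hc⟩

end Eigenbasis

section IntegralModel

open IsLocalRing Matrix.GeneralLinearGroup

variable {G R Ω : Type*} [Group G] [CommRing R] [IsLocalRing R] [CommRing Ω] {g₀ : G} {e : R}

theorem exists_residue_conj_triangular {φ : R →+* Ω} (hφ : Function.Injective φ)
    {r : G →* GL (Fin 2) R} {A : GL (Fin 2) Ω} {x b y : G → Ω}
    (hA : ∀ g, (A * map φ (r g) * A⁻¹).val = !![x g, b g; 0, y g])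
    (he : x g₀ = φ e * y g₀) (hunit : IsUnit (e ^ 2 - 1)) :
    ∃ (B : GL (Fin 2) (ResidueField R)) (a c d : G → ResidueField R),
      (∀ g, (B * map (residue R) (r g) * B⁻¹).val = !![a g, c g; 0, d g]) ∧
        a g₀ ≠ d g₀ ∧ c g₀ = 0 := by
  have hfactor : e ^ 2 - 1 = (e - 1) * (e + 1) := by ring
  rw [hfactor] at hunit
  have hconj : conjMap φ A (r g₀).val = !![φ e * y g₀, b g₀; 0, y g₀] := he ▸ hA g₀
  obtain ⟨t, ht⟩ := exists_unit_eigenvalue hφ (r g₀).isUnit hconj (isUnit_of_mul_isUnit_right hunit)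
  rw [← ht] at hconj
  let π : Matrix (Fin 2) (Fin 2) R →+* Matrix (Fin 2) (Fin 2) (ResidueField R) :=
    (residue R).mapMatrix
  have trace_π (N : Matrix (Fin 2) (Fin 2) R) : (π N).trace = residue R N.trace :=
    (AddMonoidHom.map_trace (residue R) N).symm
  have π_smul (z : R) (N : Matrix (Fin 2) (Fin 2) R) : π (z • N) = residue R z • π N :=
    Matrix.map_smul' _ _ _ (map_mul (residue R))
  have hD : π ((r g₀).val - t.val • 1) = (map (residue R) (r g₀)).val - residue R t • 1 := by
    rw [map_sub, π_smul, map_one]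
    rfl
  refine exists_conj_triangular_of_sub_scalar (s := (map (residue R)).comp r) hD ?_ ?_ fun g => ?_
  · rw [← RingHom.map_det, det_sub_scalar hconj hφ, map_zero]
  · rw [trace_π, trace_sub_scalar hconj hφ, residue_ne_zero_iff_isUnit]
    exact (isUnit_of_mul_isUnit_left hunit).mul t.isUnit
  · have hline := congrArg π (trace_smul_mul_sub_scalar hconj hφ (hA g))
    rw [π_smul, π_smul, ← trace_π, ← trace_π, map_mul] at hline
    exact hline

theorem exists_conj_triangular_of_integral_model {E : Type*} [CommRing E] {j : R →+* E}
    (hj : Function.Injective j) {ι : E →+* Ω} (hι : Function.Injective ι)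
    {ρ : G →* GL (Fin 2) E} {ρ₀ : G →* GL (Fin 2) R} {A₀ : GL (Fin 2) E}
    (hρ₀ : ∀ g, map j (ρ₀ g) = A₀ * ρ g * A₀⁻¹)
    {s : G →* GL (Fin 2) (ResidueField R)} {A₁ : GL (Fin 2) (ResidueField R)}
    (hs : ∀ g, s g = A₁ * map (residue R) (ρ₀ g) * A₁⁻¹)
    {A : GL (Fin 2) Ω} {x b y : G → Ω}
    (hA : ∀ g, (A * map ι (ρ g) * A⁻¹).val = !![x g, b g; 0, y g])
    (he : x g₀ = ι (j e) * y g₀) (hunit : IsUnit (e ^ 2 - 1)) :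
    ∃ (B : GL (Fin 2) (ResidueField R)) (a c d : G → ResidueField R),
      (∀ g, (B * s g * B⁻¹).val = !![a g, c g; 0, d g]) ∧ a g₀ ≠ d g₀ ∧ c g₀ = 0 := by
  have hA' (g : G) : (A * (map ι A₀)⁻¹ * map (ι.comp j) (ρ₀ g) * (A * (map ι A₀)⁻¹)⁻¹).val =
      !![x g, b g; 0, y g] := by
    have hmap : map (ι.comp j) (ρ₀ g) = map ι A₀ * map ι (ρ g) * (map ι A₀)⁻¹ := by
      rw [← map_mul, ← map_inv, ← map_mul, ← hρ₀ g]
      rfl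
    rw [← hA g, hmap]
    group
  obtain ⟨B, a, c, d, hB, h⟩ :=
    exists_residue_conj_triangular (φ := ι.comp j) (hι.comp hj) hA' he hunit
  refine ⟨B * A₁⁻¹, a, c, d, fun g => ?_, h⟩
  rw [← hB g, hs]
  group

end IntegralModel

section Frobenius

theorem exists_isArithFrobAt_of_profinite (R : Type*) {S G : Type*} [CommRing R] [CommRing S]
    [Algebra R S] [Group G] [MulSemiringAction G S] [SMulCommClass G R S]
    [TopologicalSpace G] [CompactSpace G] [TotallyDisconnectedSpace G] [IsTopologicalGroup G]
    (hopen : ∀ x : S, IsOpen (MulAction.stabilizer G x : Set G)) [Algebra.IsInvariant R S G]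
    [Algebra.IsIntegral R S] (Q : Ideal S) [Q.IsPrime] [Finite (R ⧸ Q.under R)] :
    ∃ σ : G, IsArithFrobAt R σ Q := by
  let _ : TopologicalSpace S := ⊥
  have : DiscreteTopology S := ⟨rfl⟩
  have : ContinuousSMul G S := continuousSMul_iff_stabilizer_isOpen.2 hopen
  have : (Q.under R).IsMaximal :=
    Ideal.Quotient.maximal_of_isField _ (Finite.isField_of_domain (R ⧸ Q.under R))
  have : Q.IsMaximal := Ideal.isMaximal_of_isIntegral_of_isMaximal_comap (R := R) Q this
  let _ : Field (R ⧸ Q.under R) := Ideal.Quotient.field _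
  let _ : Field (S ⧸ Q) := Ideal.Quotient.field Q
  cases nonempty_fintype (R ⧸ Q.under R)
  obtain ⟨σ, hσ⟩ := Ideal.Quotient.stabilizerHom_surjective_of_profinite (G := G) (Q.under R) Q
    (FiniteField.frobeniusAlgEquivOfAlgebraic (R ⧸ Q.under R) (S ⧸ Q))
  refine ⟨σ, fun x => ?_⟩
  rw [← Ideal.Quotient.eq, Nat.card_eq_fintype_card]
  exact DFunLike.congr_fun hσ (Ideal.Quotient.mk Q x)

theorem natCast_notMem_of_coprime_card {R S : Type*} [CommRing R] [CommRing S] [Algebra R S]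
    {P : Ideal S} (hP : P ≠ ⊤) {n : ℕ} (hn : n.Coprime (Nat.card (R ⧸ P.under R))) :
    (n : S) ∉ P := by
  intro hmem
  have hcard : ((Nat.card (R ⧸ P.under R) : R) : R ⧸ P.under R) = 0 := by
    rw [map_natCast, ← nsmul_one, card_nsmul_eq_zero']
  have hcard' : ((Nat.card (R ⧸ P.under R) : ℕ) : S) ∈ P := by
    simpa using Ideal.Quotient.eq_zero_iff_mem.1 hcard
  obtain ⟨x, y, hxy⟩ := hn.cast (R := S)
  exact hP ((Ideal.eq_top_iff_one P).2
    (hxy ▸ P.add_mem (P.mul_mem_left x hmem) (P.mul_mem_left y hcard')))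

variable {F L : Type*} [Field F] [Field L] [Algebra F L]

theorem isOpen_stabilizer_ringOfIntegers [Algebra.IsAlgebraic F L] (x : 𝓞 L) :
    IsOpen (MulAction.stabilizer Gal(L/F) x : Set Gal(L/F)) := by
  have hx : MulAction.stabilizer Gal(L/F) x = MulAction.stabilizer Gal(L/F) (x : L) := by
    ext g
    exact RingOfIntegers.ext_iff
  exact hx ▸ stabilizer_isOpen_of_isIntegral (K := F) (x : L)

variable [NumberField F]

variable (F L) in
theorem isFractionRing_ringOfIntegers [Algebra.IsAlgebraic F L] : IsFractionRing (𝓞 L) L := by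
  have : CharZero L := charZero_of_injective_algebraMap (algebraMap F L).injective
  have : Algebra.IsAlgebraic ℚ L := .trans ℚ F L
  have : Algebra.IsAlgebraic ℤ L := (IsFractionRing.comap_isAlgebraic_iff (K := ℚ)).2 this
  exact integralClosure.isFractionRing_of_algebraic fun x hx =>
    Int.cast_eq_zero.1 ((eq_intCast (algebraMap ℤ L) x).symm.trans hx)

instance isGaloisGroup_ringOfIntegers [IsGalois F L] : IsGaloisGroup Gal(L/F) (𝓞 F) (𝓞 L) :=
  have := isFractionRing_ringOfIntegers F L
  .of_isFractionRing Gal(L/F) (𝓞 F) (𝓞 L) F L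

theorem exists_isArithFrobAt_ringOfIntegers [IsGalois F L] (P : Ideal (𝓞 L)) [P.IsPrime]
    [Finite (𝓞 F ⧸ P.under (𝓞 F))] : ∃ σ : Gal(L/F), IsArithFrobAt (𝓞 F) σ P :=
  exists_isArithFrobAt_of_profinite (𝓞 F) isOpen_stabilizer_ringOfIntegers P

end Frobenius

section Cyclotomic

theorem toZModPow_cyclotomicCharacter_of_apply_eq_pow {L : Type*} [CommRing L] [IsDomain L]
    {p : ℕ} [Fact p.Prime] [∀ i, HasEnoughRootsOfUnity L (p ^ i)] {g : L ≃+* L} {ζ : L} {i n : ℕ}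
    (hζ : IsPrimitiveRoot ζ (p ^ i)) (hg : g ζ = ζ ^ n) :
    PadicInt.toZModPow i (cyclotomicCharacter L p g : ℤ_[p]) = n := by
  have hpow := (cyclotomicCharacter.spec p g ζ hζ.pow_eq_one).symm.trans hg
  have hfin : IsOfFinOrder ζ := isOfFinOrder_iff_pow_eq_one.2 ⟨p ^ i, NeZero.pos _, hζ.pow_eq_one⟩
  rw [hfin.pow_eq_pow_iff_modEq, ← hζ.eq_orderOf, ← ZMod.natCast_eq_natCast_iff,
    ZMod.natCast_zmod_val] at hpow
  exact hpow

theorem cyclotomicCharacter_of_isArithFrobAt {F L : Type*} [Field F] [Field L] [NumberField F]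
    [Algebra F L] [IsGalois F L] {p : ℕ} [Fact p.Prime] [∀ i, HasEnoughRootsOfUnity L (p ^ i)]
    {P : Ideal (𝓞 L)} [P.IsPrime] (hP : (p : 𝓞 L) ∉ P) {σ : Gal(L/F)}
    (hσ : IsArithFrobAt (𝓞 F) σ P) :
    (cyclotomicCharacter L p σ.toRingEquiv : ℤ_[p]) = Nat.card (𝓞 F ⧸ P.under (𝓞 F)) := by
  refine PadicInt.ext_of_toZModPow.1 fun i => ?_
  obtain ⟨ζ, hζ⟩ := HasEnoughRootsOfUnity.exists_primitiveRoot L (p ^ i)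
  let z : 𝓞 L := ⟨ζ, hζ.isIntegral (NeZero.pos _)⟩
  have hz : z ^ p ^ i = 1 := RingOfIntegers.ext hζ.pow_eq_one
  have hpi : ((p ^ i : ℕ) : 𝓞 L) ∉ P := by
    rw [Nat.cast_pow]
    exact fun h => hP (Ideal.IsPrime.mem_of_pow_mem ‹_› i h)
  have hσζ : σ ζ = ζ ^ Nat.card (𝓞 F ⧸ P.under (𝓞 F)) :=
    congrArg (algebraMap (𝓞 L) L) (AlgHom.IsArithFrobAt.apply_of_pow_eq_one hσ hz hpi)
  rw [toZModPow_cyclotomicCharacter_of_apply_eq_pow hζ hσζ, map_natCast]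

variable {F K : Type*} [Field F] [NumberField F] [Field K] [NumberField K]
  (l : HeightOneSpectrum (𝓞 K)) {ℓ : ℕ} [Fact ℓ.Prime] (hl : (ℓ : 𝓞 K) ∈ l.asIdeal)

theorem exists_cyclo_eq_card (P : Ideal (𝓞 (AlgebraicClosure F))) [P.IsPrime]
    [Finite (𝓞 F ⧸ P.under (𝓞 F))] (hℓ : ℓ.Coprime (Nat.card (𝓞 F ⧸ P.under (𝓞 F)))) :
    ∃ g₀ : decompositionGroup F P, cyclo l ℓ hl g₀.1 = Nat.card (𝓞 F ⧸ P.under (𝓞 F)) := by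
  obtain ⟨σ, hσ⟩ := exists_isArithFrobAt_ringOfIntegers (F := F) P
  have hP : (ℓ : 𝓞 (AlgebraicClosure F)) ∉ P :=
    natCast_notMem_of_coprime_card (Ideal.IsPrime.ne_top ‹_›) hℓ
  exact ⟨⟨σ, hσ.mem_stabilizer⟩, by
    rw [cyclo, cyclotomicCharacter_of_isArithFrobAt hP hσ, map_natCast]⟩

theorem residue_algebraMap_eq_zero_iff (x : 𝓞 K) :
    IsLocalRing.residue (l.adicCompletionIntegers K)
      (algebraMap (𝓞 K) (l.adicCompletionIntegers K) x) = 0 ↔ x ∈ l.asIdeal := by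
  have hle := (HeightOneSpectrum.mem_adicCompletionIntegers (𝓞 K) K l).1
    (algebraMap (𝓞 K) (l.adicCompletionIntegers K) x).2
  rw [IsLocalRing.residue_eq_zero_iff, IsLocalRing.mem_maximalIdeal, mem_nonunits_iff,
    HeightOneSpectrum.adicCompletionIntegers.isUnit_iff_valued_eq_one, ← ne_eq, ← hle.lt_iff_ne,
    ← l.valuation_lt_one_iff_mem (K := K), ← HeightOneSpectrum.valuedAdicCompletion_eq_valuation]
  rfl

end Cyclotomic

end SpecialAdjoint

open SpecialAdjoint in
theorem lemma3p4_general {F : Type*} [Field F] [NumberField F] {K : Type*} [Field K]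
    [NumberField K] (v : HeightOneSpectrum (𝓞 F))
    (P : Ideal (𝓞 (AlgebraicClosure F))) [P.IsPrime] [P.LiesOver v.asIdeal]
    (l : HeightOneSpectrum (𝓞 K)) (ℓ : ℕ) [Fact ℓ.Prime] (hl : (ℓ : 𝓞 K) ∈ l.asIdeal)
    {Ω : Type*} [Field Ω] [Algebra (l.adicCompletion K) Ω]
    (ρ : Gal(AlgebraicClosure F/F) →* GL (Fin 2) (l.adicCompletion K))
    (χ : decompositionGroup F P →* Ωˣ) (A : GL (Fin 2) Ω) (b : decompositionGroup F P → Ω)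
    (hρ : ∀ g : decompositionGroup F P,
      (A * Matrix.GeneralLinearGroup.map (algebraMap (l.adicCompletion K) Ω) (ρ g) * A⁻¹).val =
        !![algebraMap (l.adicCompletion K) Ω (cyclo l ℓ hl g.1) * χ g, b g; 0, χ g])
    (ρ' : Gal(AlgebraicClosure F/F) →* GL (Fin 2) (resField l))
    (hρ' : IsSemisimpleReduction l ρ ρ')
    (q : ℕ) (hq : q = Nat.card (𝓞 F ⧸ v.asIdeal))
    (hlq : (2 * ((q : 𝓞 K) ^ 2 - 1) * (q : 𝓞 K)) ∉ l.asIdeal)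
    (L : Type*) [Field L] [Algebra (resField l) L] :
    (adZero (ρ'.comp (decompositionGroup F P).subtype)).invariants ≠ ⊥ ↔
      (extendScalars L
        (adZero (ρ'.comp (decompositionGroup F P).subtype))).IsSemisimpleRepresentation := by
  have hres : (2 : resField l) * ((q : resField l) ^ 2 - 1) * (q : resField l) ≠ 0 := by
    rw [← residue_algebraMap_eq_zero_iff] at hlq
    simpa only [map_mul, map_sub, map_pow, map_natCast, map_ofNat, map_one] using hlq
  have h2 : (2 : resField l) ≠ 0 := left_ne_zero_of_mul (left_ne_zero_of_mul hres)
  have hunit : IsUnit ((q : l.adicCompletionIntegers K) ^ 2 - 1) := by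
    rw [← IsLocalRing.residue_ne_zero_iff_isUnit, map_sub, map_pow, map_natCast, map_one]
    exact right_ne_zero_of_mul (left_ne_zero_of_mul hres)
  have hℓq : ℓ.Coprime q := (Nat.Prime.coprime_iff_not_dvd Fact.out).2 fun hdvd =>
    hlq (Ideal.mul_mem_left _ _ (l.asIdeal.mem_of_dvd (Nat.cast_dvd_cast hdvd) hl))
  rw [P.over_def v.asIdeal] at hq
  have : Finite (𝓞 F ⧸ P.under (𝓞 F)) := P.over_def v.asIdeal ▸ inferInstance
  obtain ⟨ρ₀, A₀, hρ₀, ⟨-, A₁, hA₁⟩ | ⟨a, d, _, _, B, hB⟩⟩ := hρ'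
  · obtain ⟨g₀, hg₀⟩ := exists_cyclo_eq_card l hl P (hq ▸ hℓq)
    obtain ⟨B, a, c, d, hB, had, hc⟩ := exists_conj_triangular_of_integral_model
      (j := algebraMap (l.adicCompletionIntegers K) (l.adicCompletion K)) Subtype.val_injective
      (algebraMap (l.adicCompletion K) Ω).injective
      (ρ := ρ.comp (decompositionGroup F P).subtype)
      (ρ₀ := ρ₀.comp (decompositionGroup F P).subtype) (fun g => hρ₀ g)
      (s := ρ'.comp (decompositionGroup F P).subtype) (fun g => hA₁ g) hρ
      (g₀ := g₀) (e := (q : l.adicCompletionIntegers K)) (by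
        rw [hg₀, ← hq, map_natCast, map_natCast, map_natCast]) hunit
    exact adZero_invariants_ne_bot_iff_of_conj_triangular h2 hB had hc L
  · have hdiag : ∀ g : decompositionGroup F P,
        (B * (ρ'.comp (decompositionGroup F P).subtype) g * B⁻¹).val =
          !![(a g : resField l), 0; 0, (d g : resField l)] := fun g => (hB g).2
    exact adZero_invariants_ne_bot_iff_of_conj_diagonal hdiag L

open SpecialAdjoint in
theorem lemma3p4 {F : Type*} [Field F] [NumberField F] {K : Type*} [Field K] [NumberField K]
    (v : HeightOneSpectrum (𝓞 F))
    (P : Ideal (𝓞 (AlgebraicClosure F))) [P.IsPrime] [P.LiesOver v.asIdeal]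
    (l : HeightOneSpectrum (𝓞 K)) (ℓ : ℕ) [Fact ℓ.Prime] (hl : (ℓ : 𝓞 K) ∈ l.asIdeal)
    (ρ : Gal(AlgebraicClosure F/F) →* GL (Fin 2) (l.adicCompletion K)) (hρ : Continuous ρ)
    (hspecial : IsSpecialAt l ℓ hl P ρ)
    (ρ' : Gal(AlgebraicClosure F/F) →* GL (Fin 2) (resField l))
    (hρ' : IsSemisimpleReduction l ρ ρ')
    (q : ℕ) (hq : q = Nat.card (𝓞 F ⧸ v.asIdeal))
    (hlq : (2 * ((q : 𝓞 K) ^ 2 - 1) * (q : 𝓞 K)) ∉ l.asIdeal) :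
    (adZero (ρ'.comp (decompositionGroup F P).subtype)).invariants ≠ ⊥ ↔
      (extendScalars (AlgebraicClosure (resField l))
        (adZero (ρ'.comp (decompositionGroup F P).subtype))).IsSemisimpleRepresentation := by
  obtain ⟨χ, ⟨A, b, hA⟩, -⟩ := hspecial
  exact lemma3p4_general v P l ℓ hl ρ χ A b hA ρ' hρ' q hq hlq _
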